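/- Let $d\ge 2$, let $e_1,\dots,e_d$ be the canonical basis of $\mathbb{Z}^d$, and let $\mathcal{E}_+=\{e_1,\dots,e_d\}$ and $\mathcal{E}=\{\pm e_1,\dots,\pm e_d\}$. Let $E_1,\dots,E_k\subset\mathcal{E}_+$ be sets that all contain $e_1$, and let $r_1,\dots,r_k\ge 0$ with $\sum_i r_i=1$. Let $(U_x)_{x\in\mathbb{Z}^d}$, $(U'_x)_{x\in\mathbb{Z}^d}$ be i.i.d. random variables, uniform on $(0,1]$. For $p\in[0,1]$ and $x\in\mathbb{Z}^d$, put $\mathcal{G}_x=E_i$ if $U_x<p$ and $U'_x\in[\sum_{j<i}r_j,\sum_{j\le i}r_j)$, and $\mathcal{G}_x=\mathcal{E}$ if $U_x\ge p$ (the null event that some $U'_x=1$ is disregarded). Insert an arrow from each $x$ to each $x+e$, $e\in\mathcal{G}_x$. Let $\mathcal{C}_x$ be the set of vertices that can be reached from $x$ by following arrows (including $x$), $\mathcal{B}_x=\{y: x\in\mathcal{C}_y\}$, and $\mathcal{M}_x=\mathcal{C}_x\cap\mathcal{B}_x$; let $o$ be the origin, and $L_x=\inf\{n\in\mathbb{Z}: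 x+ne_1\in\mathcal{C}_o\}\in[-\infty,\infty]$. Then there is $p_c\in(0,1)$, depending only on $d$, $(E_i)$ and $(r_i)$, which is the critical value of the forward cluster, that is, - if $0\le p<p_c$ then $\mathcal{C}_o=\mathbb{Z}^d$ almost surely, - if $p_c<p\le 1$ then $\mathcal{C}_o\ne\mathbb{Z}^d$ almost surely, and if moreover $p<1$ then almost surely $L_x$ is finite for every $x\in\mathbb{Z}^d$, and $\mathcal{M}_o$ has its transition at the same value: - if $0\le p<p_c$ then $\mathcal{M}_o=\mathbb{Z}^d$ almost surely, - if $p_c<p\le 1$ then $\mathcal{M}_o\ne\mathbb{Z}^d$ almost surely. -/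

import Mathlib

open MeasureTheory ProbabilityTheory Set

namespace DRE

/-- The set of canonical basis vectors of `ℤ^d`. -/
def posUnits (d : ℕ) : Set (Fin d → ℤ) := {e | ∃ i : Fin d, e = Pi.single i 1}

/-- The set of the `2 * d` unit vectors `±e_i` of `ℤ^d`. -/
def units (d : ℕ) : Set (Fin d → ℤ) :=
  {e | ∃ i : Fin d, e = Pi.single i 1 ∨ e = -Pi.single i 1}

/-- The first canonical basis vector of `ℤ^d`, for `d ≥ 2`. -/
def e₁ (d : ℕ) (hd : 2 ≤ d) : Fin d → ℤ := Pi.single ⟨0, by omega⟩ 1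

/-- The pair `(U, U')` consists of families of random variables, indexed by `ℤ^d`, that are
(all together) i.i.d. and uniform on `(0, 1]`. -/
structure IsIIDUniform {d : ℕ} {Ω : Type*} [MeasurableSpace Ω] (P : Measure Ω)
    (U U' : (Fin d → ℤ) → Ω → ℝ) : Prop where
  measurable_fst : ∀ x, Measurable (U x)
  measurable_snd : ∀ x, Measurable (U' x)
  uniform_fst : ∀ x, pdf.IsUniform (U x) (Ioc (0 : ℝ) 1) P volume
  uniform_snd : ∀ x, pdf.IsUniform (U' x) (Ioc (0 : ℝ) 1) P volume
  indep : iIndepFun (Sum.elim U U') P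

/-- The `i`-th of the consecutive half-open intervals of lengths `r_1, r_2, …` that start
at `0`. -/
def piece {k : ℕ} (r : Fin k → ℝ) (i : Fin k) : Set ℝ :=
  Ico (∑ j ∈ Finset.Iio i, r j) (∑ j ∈ Finset.Iic i, r j)

/-- The local environment at a site whose two uniform variables have the values `u` and `u'`:
it is `E i` if `u < p` and `u'` lies in the `i`-th piece for `r`, and `F i` if `p ≤ u` and `u'`
lies in the `i`-th piece for `q`. (It is empty if `u'` lies in no piece, which for `u'` uniform
on `(0, 1]` has probability zero.) -/
def localEnv {d k l : ℕ} (E : Fin k → Set (Fin d → ℤ)) (F : Fin l → Set (Fin d → ℤ))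
    (r : Fin k → ℝ) (q : Fin l → ℝ) (p u u' : ℝ) : Set (Fin d → ℤ) :=
  {e | (u < p ∧ ∃ i, u' ∈ piece r i ∧ e ∈ E i) ∨ (p ≤ u ∧ ∃ i, u' ∈ piece q i ∧ e ∈ F i)}

/-- There is an arrow from `x` to `y` if `y = x + e` for some `e ∈ G x`. -/
def Arrow {d : ℕ} (G : (Fin d → ℤ) → Set (Fin d → ℤ)) (x y : Fin d → ℤ) : Prop :=
  ∃ e ∈ G x, y = x + e

/-- The forward cluster of `x`: the vertices that can be reached from `x` by following
finitely many arrows. -/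
def forward {d : ℕ} (G : (Fin d → ℤ) → Set (Fin d → ℤ)) (x : Fin d → ℤ) : Set (Fin d → ℤ) :=
  {y | Relation.ReflTransGen (Arrow G) x y}

/-- The backward cluster of `x`. -/
def backward {d : ℕ} (G : (Fin d → ℤ) → Set (Fin d → ℤ)) (x : Fin d → ℤ) : Set (Fin d → ℤ) :=
  {y | x ∈ forward G y}

/-- The mutual cluster of `x`: the intersection of its forward and backward clusters. -/
def mutualCluster {d : ℕ} (G : (Fin d → ℤ) → Set (Fin d → ℤ)) (x : Fin d → ℤ) : Set (Fin d → ℤ) :=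
  forward G x ∩ backward G x

/-- `L_x`: the infimum (possibly `±∞`) of the integers `k` such that `x + k e_1` belongs to the
forward cluster of the origin. -/
noncomputable def lowerEnd {d : ℕ} (hd : 2 ≤ d) (G : (Fin d → ℤ) → Set (Fin d → ℤ))
    (x : Fin d → ℤ) : EReal :=
  sInf ((fun k : ℤ => ((k : ℝ) : EReal)) '' {k : ℤ | x + k • e₁ d hd ∈ forward G 0})

/-- The environment of the general model in the realisation `ω`. -/
def env {d k l : ℕ} {Ω : Type*} (E : Fin k → Set (Fin d → ℤ)) (F : Fin l → Set (Fin d → ℤ))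
    (r : Fin k → ℝ) (q : Fin l → ℝ) (U U' : (Fin d → ℤ) → Ω → ℝ) (p : ℝ) (ω : Ω)
    (x : Fin d → ℤ) : Set (Fin d → ℤ) :=
  localEnv E F r q p (U x ω) (U' x ω)

/-- The environment of the model in which the only environment of the second kind is the set of
all unit vectors. -/
def envFull {d k : ℕ} {Ω : Type*} (E : Fin k → Set (Fin d → ℤ)) (r : Fin k → ℝ)
    (U U' : (Fin d → ℤ) → Ω → ℝ) (p : ℝ) (ω : Ω) : (Fin d → ℤ) → Set (Fin d → ℤ) :=
  env E (fun _ : Fin 1 => units d) r (fun _ : Fin 1 => (1 : ℝ)) U U' p ω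

end DRE

namespace DRE

/-! Put all environments on the product space of the uniforms. Raising `p` with the uniforms fixed
only removes arrows (`config_anti`), so covering of the lattice by the forward cluster is monotone
in `p`. The critical value is the supremum of the parameters for which covering has probability one.

Since `e₁` is always available, covering from `e₁` implies covering from the origin. The covering
event is thus almost surely sub-invariant under an ergodic shift and has probability zero or one
(`ae_forward_eq_univ_or_ae_ne`). For `p < 1` every line parallel to `e₁` has full sites in both
directions. The cluster therefore meets every line and, unless it is everything, meets each in a
half-line (`forward_eq_univ_or_ray`).

At `p = 1/64`, non-covering would give finite left ends in all rows of a coordinate plane. These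
ends force long closed segments, and a sum over possible ends shows that this has probability zero
(`law_barrier_le`). Near `p = 1`, reaching `-n e₁` requires many steps out of full sites, and
counting self-avoiding walks makes this exponentially unlikely (`law_avoidingWalk_le`). So the
critical value lies strictly between 0 and 1.

The mutual cluster lies inside the forward cluster; conversely, if almost surely every site reaches
every site, the mutual cluster is everything. -/

/-! ### Ergodicity of reindexing maps on product spaces -/

open scoped symmDiff in
/-- A reindexing that moves every finite set of indices off itself after finitely many steps is
ergodic for a product of copies of a probability measure. -/
theorem ergodic_reindex {ι : Type*} (ν : Measure ℝ) [IsProbabilityMeasure ν] (f : ι → ι)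
    (hf : Function.Injective f)
    (hdisj : ∀ I : Finset ι, ∃ n : ℕ, ∀ i ∈ I, f^[n] i ∉ I) :
    Ergodic (fun (ω : ι → ℝ) i => ω (f i)) (Measure.infinitePi fun _ : ι => ν) := by
  classical
  set μ := Measure.infinitePi fun _ : ι => ν with hμ
  set T : (ι → ℝ) → (ι → ℝ) := fun ω i => ω (f i) with hT
  have hmp : MeasurePreserving T μ μ :=
    ⟨by fun_prop, Measure.map_infinitePi_infinitePi_of_inj (P := fun _ : ι => ν) hf⟩
  have hiter : ∀ n : ℕ, T^[n] = fun ω i => ω (f^[n] i) := by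
    intro n
    induction n with
    | zero => rfl
    | succ n ih =>
      rw [Function.iterate_succ', ih]
      funext ω i
      simp [hT, Function.iterate_succ_apply]
  refine ⟨hmp, ⟨fun s hs hinv => ?_⟩⟩
  suffices h : μ.real s = μ.real s * μ.real s by
    have h01 : μ.real s = 0 ∨ μ.real s = 1 := by
      rcases eq_or_ne (μ.real s) 0 with h0 | h0
      · exact Or.inl h0
      · exact Or.inr (mul_left_cancel₀ h0 (by linarith))
    rw [Filter.eventuallyConst_set']
    rcases h01 with h0 | h1
    · left
      rw [ae_eq_empty]
      exact (measureReal_eq_zero_iff).1 h0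
    · right
      rw [ae_eq_univ, prob_compl_eq_zero_iff hs]
      rwa [Measure.real, ENNReal.toReal_eq_one_iff] at h1
  -- Approximate `s` by a cylinder `t`. A high iterate makes `t` and its preimage independent, while
  -- `s` is unchanged, so `s` is nearly independent of itself.
  have key : ∀ ε : ℝ, 0 < ε → |μ.real s - μ.real s * μ.real s| ≤ 4 * ε := by
    intro ε hε
    obtain ⟨t, htC, hts⟩ := exists_measure_symmDiff_lt_of_generateFrom_isSetRing (μ := μ)
      (C := measurableCylinders fun _ : ι => ℝ) isSetRing_measurableCylinders
      ⟨{univ}, by simp,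
        by simpa only [singleton_subset_iff] using univ_mem_measurableCylinders _, by simp⟩
      generateFrom_measurableCylinders.symm hs (ENNReal.ofReal_pos.2 hε)
    obtain ⟨I, S, hS, rfl⟩ := (mem_measurableCylinders _).1 htC
    set t := cylinder (α := fun _ => ℝ) I S with ht
    have htm : MeasurableSet t := hS.cylinder
    have hts' : μ.real (t ∆ s) ≤ ε := by
      rw [Measure.real]
      exact ENNReal.toReal_le_of_le_ofReal hε.le hts.le
    obtain ⟨n, hn⟩ := hdisj I
    have hmpn : MeasurePreserving (T^[n]) μ μ := hmp.iterate n
    have hsn : T^[n] ⁻¹' s = s := Function.IsFixedPt.preimage_iterate hinv n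
    have hind : IndepFun (fun (ω : ι → ℝ) (i : I) => ω i)
        (fun (ω : ι → ℝ) (i : I.image f^[n]) => ω i) μ := by
      refine iIndepFun.indepFun_finset (f := fun (i : ι) (ω : ι → ℝ) => ω i) I (I.image f^[n]) ?_ ?_ ?_
      · rw [Finset.disjoint_left]
        intro i hi hi'
        obtain ⟨j, hj, rfl⟩ := Finset.mem_image.1 hi'
        exact hn j hj hi
      · exact iIndepFun_infinitePi (P := fun _ : ι => ν) (X := fun _ x => x)
          (fun _ => measurable_id)
      · intro i; fun_prop
    have hprod : μ.real (t ∩ T^[n] ⁻¹' t) = μ.real t * μ.real t := by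
      set φ : (I.image f^[n] → ℝ) → (I → ℝ) :=
        fun y i => y ⟨f^[n] i, Finset.mem_image_of_mem _ i.2⟩ with hφ
      have h1 : T^[n] ⁻¹' t = (fun (ω : ι → ℝ) (i : I.image f^[n]) => ω i) ⁻¹' (φ ⁻¹' S) := by
        rw [hiter]
        rfl
      have h2 : t = (fun (ω : ι → ℝ) (i : I) => ω i) ⁻¹' S := rfl
      have h3 := hind.measure_inter_preimage_eq_mul S (φ ⁻¹' S) hS
        ((by fun_prop : Measurable φ) hS)
      rw [← h1, ← h2, hmpn.measure_preimage htm.nullMeasurableSet] at h3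
      rw [Measure.real, h3, ENNReal.toReal_mul]
      rfl
    have hA : |μ.real (t ∩ T^[n] ⁻¹' t) - μ.real s| ≤ ε + ε := by
      refine (abs_measureReal_sub_le_measureReal_symmDiff
        (htm.inter (hmpn.measurable htm)).nullMeasurableSet hs.nullMeasurableSet).trans ?_
      have hsub : (t ∩ T^[n] ⁻¹' t) ∆ s ⊆ (t ∆ s) ∪ (T^[n] ⁻¹' (t ∆ s)) := by
        conv_lhs => rw [← inter_self s]
        conv_lhs => enter [2, 2]; rw [← hsn]
        rintro ω (⟨⟨h1, h2⟩, h3⟩ | ⟨⟨h1, h2⟩, h3⟩)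
        · by_cases hω : ω ∈ s
          · right; left; exact ⟨h2, fun h => h3 ⟨hω, h⟩⟩
          · left; left; exact ⟨h1, hω⟩
        · by_cases hω : ω ∈ t
          · right; right; exact ⟨h2, fun h => h3 ⟨hω, h⟩⟩
          · left; right; exact ⟨h1, hω⟩
      refine (measureReal_mono hsub).trans ((measureReal_union_le _ _).trans ?_)
      have : μ.real (T^[n] ⁻¹' (t ∆ s)) = μ.real (t ∆ s) := by
        rw [Measure.real, hmpn.measure_preimage (htm.symmDiff hs).nullMeasurableSet]; rfl
      rw [this]
      exact add_le_add hts' hts'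
    have hB : |μ.real t - μ.real s| ≤ ε :=
      (abs_measureReal_sub_le_measureReal_symmDiff htm.nullMeasurableSet
        hs.nullMeasurableSet).trans hts'
    rw [hprod] at hA
    have ht1 : μ.real t ≤ 1 := measureReal_le_one
    have hs1 : μ.real s ≤ 1 := measureReal_le_one
    have ht0 : 0 ≤ μ.real t := measureReal_nonneg
    have hs0 : 0 ≤ μ.real s := measureReal_nonneg
    -- Replacing the intersection costs `2ε`; replacing `t` by `s` in the square costs another `2ε`,
    -- as both measures are at most one.
    rw [abs_le] at hA hB ⊢
    constructor <;> nlinarith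
  have h0 : |μ.real s - μ.real s * μ.real s| ≤ 0 := by
    refine le_of_forall_pos_le_add fun ε hε => ?_
    have := key (ε / 4) (by positivity)
    linarith
  exact sub_eq_zero.1 (abs_nonpos_iff.1 h0)

/-! ### The law of the uniforms and its shifts -/

/-- The uniform distribution on `(0, 1]`. -/
noncomputable def unif : Measure ℝ := ProbabilityTheory.cond volume (Ioc (0 : ℝ) 1)

theorem unif_eq : unif = volume.restrict (Ioc (0 : ℝ) 1) := by
  simp [unif, ProbabilityTheory.cond]

instance : IsProbabilityMeasure unif := ⟨by simp [unif_eq]⟩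

theorem unif_Iio {p : ℝ} (hp1 : p ≤ 1) : unif (Iio p) = ENNReal.ofReal p := by
  rw [unif_eq, Measure.restrict_apply measurableSet_Iio]
  have : Iio p ∩ Ioc 0 1 = Ioo 0 p := by
    ext x
    simp only [mem_inter_iff, mem_Iio, mem_Ioc, mem_Ioo]
    constructor
    · rintro ⟨h1, h2, h3⟩; exact ⟨h2, h1⟩
    · rintro ⟨h1, h2⟩; exact ⟨h2, h1, by linarith⟩
  rw [this]
  simp

theorem unif_Ici {p : ℝ} (hp0 : 0 < p) : unif (Ici p) = ENNReal.ofReal (1 - p) := by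
  rw [unif_eq, Measure.restrict_apply measurableSet_Ici]
  have : Ici p ∩ Ioc 0 1 = Icc p 1 := by
    ext x
    simp only [mem_inter_iff, mem_Ici, mem_Ioc, mem_Icc]
    constructor
    · rintro ⟨h1, h2, h3⟩; exact ⟨h1, h3⟩
    · rintro ⟨h1, h2⟩; exact ⟨h1, by linarith, h2⟩
  rw [this]
  simp

theorem unif_compl_Ioo : unif (Ioo 0 1)ᶜ = 0 := by
  rw [unif_eq, Measure.restrict_apply measurableSet_Ioo.compl]
  have : (Ioo (0 : ℝ) 1)ᶜ ∩ Ioc 0 1 = {1} := by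
    ext x
    simp only [mem_inter_iff, mem_compl_iff, mem_Ioo, mem_Ioc, mem_singleton_iff]
    constructor
    · rintro ⟨h1, h2, h3⟩
      by_contra hne
      exact h1 ⟨h2, lt_of_le_of_ne h3 hne⟩
    · rintro rfl; norm_num
  rw [this]
  simp

/-- The joint law of all the uniform variables. -/
noncomputable def law (d : ℕ) : Measure ((Fin d → ℤ) ⊕ (Fin d → ℤ) → ℝ) :=
  Measure.infinitePi fun _ => unif

instance (d : ℕ) : IsProbabilityMeasure (law d) := by unfold law; infer_instance

/-- Transfers almost sure statements from the canonical space to any realisation, so that the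
critical value does not depend on the probability space. -/
theorem IsIIDUniform.measurePreserving {d : ℕ} {Ω : Type*} [MeasurableSpace Ω] {P : Measure Ω}
    {U U' : (Fin d → ℤ) → Ω → ℝ} (h : IsIIDUniform P U U') :
    MeasurePreserving (fun ω i => Sum.elim U U' i ω) P (law d) := by
  have hm : ∀ i, Measurable (Sum.elim U U' i) := by
    rintro (x | x)
    · exact h.measurable_fst x
    · exact h.measurable_snd x
  refine ⟨measurable_pi_iff.2 hm, ?_⟩
  rw [h.indep.map_fun_eq_infinitePi_map hm, law]
  congr 1
  funext i
  rcases i with x | x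
  · exact h.uniform_fst x
  · exact h.uniform_snd x

/-- The shift of the uniform variables by `v`. -/
def shift {d : ℕ} (v : Fin d → ℤ) (ω : (Fin d → ℤ) ⊕ (Fin d → ℤ) → ℝ) :
    (Fin d → ℤ) ⊕ (Fin d → ℤ) → ℝ :=
  fun i => ω (Sum.map (· + v) (· + v) i)

theorem measurePreserving_shift {d : ℕ} (v : Fin d → ℤ) :
    MeasurePreserving (shift v) (law d) (law d) :=
  ⟨measurable_pi_iff.2 fun _ => measurable_pi_apply _,
    Measure.map_infinitePi_infinitePi_of_inj (P := fun _ => unif)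
      (Sum.map_injective.2 ⟨add_left_injective v, add_left_injective v⟩)⟩

theorem ergodic_shift {d : ℕ} {v : Fin d → ℤ} (hv : v ≠ 0) : Ergodic (shift v) (law d) := by
  classical
  refine ergodic_reindex unif _
    (Sum.map_injective.2 ⟨add_left_injective v, add_left_injective v⟩) fun I => ?_
  have hit : ∀ n : ℕ, (Sum.map (· + v) (· + v))^[n] =
      (Sum.map (· + n • v) (· + n • v) : (Fin d → ℤ) ⊕ (Fin d → ℤ) → _) := by
    intro n
    induction n with
    | zero => funext i; rcases i with x | x <;> simp
    | succ n ih =>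
      rw [Function.iterate_succ', ih]
      funext i
      rcases i with x | x <;> simp [add_assoc, add_mul]
  obtain ⟨j, hj⟩ := Function.ne_iff.1 hv
  let c : (Fin d → ℤ) ⊕ (Fin d → ℤ) → ℤ := Sum.elim (fun x => x j) (fun x => x j)
  obtain ⟨B, hB⟩ := (I.image fun i => |c i|).bddAbove
  -- Coordinate `j` of all indices in `I` lies in `[-B, B]`, and a displacement of at least `2B + 1`
  -- leaves that interval.
  refine ⟨(2 * B + 1).toNat, fun i hi hi' => ?_⟩
  have h1 : |c i| ≤ B := hB (Finset.mem_coe.2 (Finset.mem_image_of_mem (fun i => |c i|) hi))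
  have h2 := hB (Finset.mem_coe.2 (Finset.mem_image_of_mem (fun i => |c i|) hi'))
  rw [hit] at h2
  have h3 : c (Sum.map (· + (2 * B + 1).toNat • v) (· + (2 * B + 1).toNat • v) i) =
      c i + (2 * B + 1).toNat * v j := by
    rcases i with x | x <;> simp [c]
  rw [h3, abs_le] at h2
  rw [abs_le] at h1
  have h4 : (((2 * B + 1).toNat : ℕ) : ℤ) = 2 * B + 1 := Int.toNat_of_nonneg (by linarith)
  rw [h4] at h2
  simp only [Pi.zero_apply] at hj
  rcases lt_or_gt_of_ne hj with h | h <;> nlinarith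

/-! ### Environments on the canonical space -/

/-- The environment as a function of the values of the uniform variables. -/
def config {d k : ℕ} (E : Fin k → Set (Fin d → ℤ)) (r : Fin k → ℝ) (p : ℝ)
    (ω : (Fin d → ℤ) ⊕ (Fin d → ℤ) → ℝ) (x : Fin d → ℤ) : Set (Fin d → ℤ) :=
  localEnv E (fun _ : Fin 1 => units d) r (fun _ : Fin 1 => (1 : ℝ)) p
    (ω (Sum.inl x)) (ω (Sum.inr x))

theorem posUnits_subset_units (d : ℕ) : posUnits d ⊆ units d := by
  rintro e ⟨i, rfl⟩
  exact ⟨i, Or.inl rfl⟩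

theorem piece_one (i : Fin 1) : piece (fun _ : Fin 1 => (1 : ℝ)) i = Ico 0 1 := by
  have h1 : Finset.Iio i = ∅ := by
    ext j; simp [Subsingleton.elim j i]
  have h2 : Finset.Iic i = {i} := by
    ext j; simp [Subsingleton.elim j i]
  simp [piece, h1, h2]

/-- If `u` were in no piece, induction would put every partial sum at or below `u`, including the
total sum 1. -/
theorem exists_mem_piece {k : ℕ} {r : Fin k → ℝ} (hr1 : ∑ i, r i = 1) {u : ℝ}
    (hu0 : 0 ≤ u) (hu1 : u < 1) : ∃ i, u ∈ piece r i := by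
  by_contra! hno
  have hle : ∀ (n : ℕ) (hn : n < k), ∑ j ∈ Finset.Iic (⟨n, hn⟩ : Fin k), r j ≤ u := by
    intro n
    induction n with
    | zero =>
      intro hn
      by_contra! hlt
      refine hno ⟨0, hn⟩ ⟨?_, hlt⟩
      have : Finset.Iio (⟨0, hn⟩ : Fin k) = ∅ := by
        ext j; simp [Fin.lt_def]
      simpa [this] using hu0
    | succ n ih =>
      intro hn
      by_contra! hlt
      refine hno ⟨n + 1, hn⟩ ⟨?_, hlt⟩
      have : Finset.Iio (⟨n + 1, hn⟩ : Fin k) = Finset.Iic ⟨n, by omega⟩ := by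
        ext j; simp only [Finset.mem_Iio, Finset.mem_Iic, Fin.lt_def, Fin.le_def]; omega
      rw [this]
      exact ih _
  rcases Nat.eq_zero_or_pos k with rfl | hk
  · simp at hr1
  · have h := hle (k - 1) (by omega)
    have : Finset.Iic (⟨k - 1, by omega⟩ : Fin k) = Finset.univ := by
      ext j
      have := j.2
      simp only [Finset.mem_Iic, Fin.le_def, Finset.mem_univ, iff_true]; omega
    rw [this, hr1] at h
    linarith

section Config

variable {d k : ℕ} {E : Fin k → Set (Fin d → ℤ)} {r : Fin k → ℝ} {p p' : ℝ}
  {ω : (Fin d → ℤ) ⊕ (Fin d → ℤ) → ℝ}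

theorem config_of_le (hω : ∀ i, ω i ∈ Ioo (0 : ℝ) 1) {x : Fin d → ℤ} (h : p ≤ ω (Sum.inl x)) :
    config E r p ω x = units d := by
  ext e
  have := hω (Sum.inr x)
  simp only [config, localEnv, piece_one, mem_ofPred_eq, mem_Ico]
  constructor
  · rintro (⟨h1, -⟩ | ⟨-, -, -, h2⟩)
    · exact absurd h1 (not_lt.2 h)
    · exact h2
  · intro he
    exact Or.inr ⟨h, 0, ⟨this.1.le, this.2⟩, he⟩

theorem config_subset_posUnits (hE : ∀ i, E i ⊆ posUnits d) {x : Fin d → ℤ}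
    (h : ω (Sum.inl x) < p) : config E r p ω x ⊆ posUnits d := by
  rintro e (⟨-, i, -, he⟩ | ⟨h1, -⟩)
  · exact hE i he
  · exact absurd h1 (not_le.2 h)

theorem config_anti (hω : ∀ i, ω i ∈ Ioo (0 : ℝ) 1) (hE : ∀ i, E i ⊆ posUnits d) (hp : p ≤ p')
    (x : Fin d → ℤ) : config E r p' ω x ⊆ config E r p ω x := by
  intro e he
  rcases le_or_gt p (ω (Sum.inl x)) with h | h
  · rw [config_of_le hω h]
    rcases he with ⟨-, i, -, he'⟩ | ⟨-, _, -, he'⟩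
    · exact posUnits_subset_units d (hE i he')
    · exact he'
  · rcases he with ⟨-, h'⟩ | ⟨h1, -⟩
    · exact Or.inl ⟨h, h'⟩
    · exact absurd h1 (not_le.2 (h.trans_le hp))

theorem e₁_mem_config (hω : ∀ i, ω i ∈ Ioo (0 : ℝ) 1) (hr1 : ∑ i, r i = 1) {hd : 2 ≤ d}
    (hE₁ : ∀ i, e₁ d hd ∈ E i) (x : Fin d → ℤ) : e₁ d hd ∈ config E r p ω x := by
  rcases le_or_gt p (ω (Sum.inl x)) with h | h
  · rw [config_of_le hω h]
    exact ⟨_, Or.inl rfl⟩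
  · have := hω (Sum.inr x)
    obtain ⟨i, hi⟩ := exists_mem_piece hr1 this.1.le this.2
    exact Or.inl ⟨h, i, hi, hE₁ i⟩

end Config

/-! ### Deterministic properties of forward clusters -/

section Graph

variable {d : ℕ} {G G' : (Fin d → ℤ) → Set (Fin d → ℤ)}

theorem self_mem_forward (x : Fin d → ℤ) : x ∈ forward G x := Relation.ReflTransGen.refl

theorem forward_step {x y e : Fin d → ℤ} (hy : y ∈ forward G x) (he : e ∈ G y) :
    y + e ∈ forward G x :=
  Relation.ReflTransGen.tail hy ⟨e, he, rfl⟩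

theorem forward_mono (h : ∀ x, G x ⊆ G' x) (x : Fin d → ℤ) : forward G x ⊆ forward G' x :=
  fun _ hy => Relation.ReflTransGen.mono (fun _ _ ⟨e, he, h'⟩ => ⟨e, h _ he, h'⟩) _ _ hy

theorem forward_subset_forward {x y : Fin d → ℤ} (h : y ∈ forward G x) :
    forward G y ⊆ forward G x :=
  fun _ hz => Relation.ReflTransGen.trans h hz

theorem mem_forward_translate (v x y : Fin d → ℤ) :
    y ∈ forward (fun z => G (z + v)) x ↔ y + v ∈ forward G (x + v) := by
  constructor
  · intro h
    refine Relation.ReflTransGen.lift (· + v) ?_ _ _ h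
    rintro a b ⟨e, he, rfl⟩
    exact ⟨e, he, by simp only; abel⟩
  · intro h
    have := Relation.ReflTransGen.lift (p := Arrow fun z => G (z + v)) (· - v) ?_ _ _ h
    · simpa [forward, Function.onFun] using this
    · rintro a b ⟨e, he, rfl⟩
      exact ⟨e, by simpa using he, by simp only; abel⟩

theorem forward_translate_eq_univ_iff (v : Fin d → ℤ) :
    forward (fun z => G (z + v)) 0 = univ ↔ forward G v = univ := by
  simp only [eq_univ_iff_forall, mem_forward_translate, zero_add]
  exact ⟨fun h x => by simpa using h (x - v), fun h x => h _⟩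

/-- There is a directed walk of `n` steps from `x` to `y`. -/
def WalkTo (G : (Fin d → ℤ) → Set (Fin d → ℤ)) : ℕ → (Fin d → ℤ) → (Fin d → ℤ) → Prop
  | 0, x, y => x = y
  | n + 1, x, y => ∃ e ∈ G x, WalkTo G n (x + e) y

/-- Step counts give measurability by induction on the length, and also shortest walks. -/
theorem mem_forward_iff_exists_walkTo {x y : Fin d → ℤ} :
    y ∈ forward G x ↔ ∃ n, WalkTo G n x y := by
  constructor
  · intro h
    induction h using Relation.ReflTransGen.head_induction_on with
    | refl => exact ⟨0, rfl⟩
    | head h _ ih =>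
      obtain ⟨e, he, rfl⟩ := h
      obtain ⟨n, hn⟩ := ih
      exact ⟨n + 1, e, he, hn⟩
  · rintro ⟨n, hn⟩
    induction n generalizing x with
    | zero => cases hn; exact self_mem_forward _
    | succ n ih =>
      obtain ⟨e, he, h⟩ := hn
      exact Relation.ReflTransGen.head ⟨e, he, rfl⟩ (ih h)

theorem units_connected {Q : (Fin d → ℤ) → Prop} (h : ∀ x, Q x → ∀ e ∈ units d, Q (x + e))
    {x : Fin d → ℤ} (hx : Q x) (y : Fin d → ℤ) : Q y := by
  have hsingle : ∀ (i : Fin d) (n : ℕ) x, Q x →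
      Q (x + n • Pi.single i 1) ∧ Q (x - n • Pi.single i 1) := by
    intro i n
    induction n with
    | zero => intro x hx; simpa using hx
    | succ n ih =>
      intro x hx
      constructor
      · have := h _ (ih x hx).1 (Pi.single i 1) ⟨i, Or.inl rfl⟩
        rwa [add_assoc, ← succ_nsmul] at this
      · have := h _ (ih x hx).2 (-Pi.single i 1) ⟨i, Or.inr rfl⟩
        rwa [← sub_eq_add_neg, sub_sub, ← succ_nsmul] at this
  have hint : ∀ (i : Fin d) (n : ℤ) x, Q x → Q (x + Pi.single i n) := by
    intro i n x hx
    obtain ⟨m, rfl | rfl⟩ := n.eq_nat_or_neg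
    · have h1 := (hsingle i m x hx).1
      rwa [← Pi.single_smul, nsmul_one] at h1
    · have h1 := (hsingle i m x hx).2
      rwa [← Pi.single_smul, nsmul_one, sub_eq_add_neg, ← Pi.single_neg] at h1
  have hsum : ∀ s : Finset (Fin d), Q (x + ∑ i ∈ s, Pi.single i ((y - x) i)) := by
    classical
    intro s
    induction s using Finset.induction_on with
    | empty => simpa using hx
    | insert i s hi ih =>
      rw [Finset.sum_insert hi, add_comm (Pi.single _ _), ← add_assoc]
      exact hint _ _ _ ih
  have := hsum Finset.univ
  rwa [Finset.univ_sum_single, add_sub_cancel] at this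

/-- The integers `n` such that `x + n e` belongs to the forward cluster of the origin. -/
def ray (G : (Fin d → ℤ) → Set (Fin d → ℤ)) (e x : Fin d → ℤ) : Set ℤ :=
  {n | x + n • e ∈ forward G 0}

theorem ray_add_nat {e x : Fin d → ℤ} (he : ∀ x, e ∈ G x) {n : ℤ} (hn : n ∈ ray G e x) (m : ℕ) :
    n + m ∈ ray G e x := by
  induction m with
  | zero => simpa using hn
  | succ m ih =>
    have := forward_step ih (he _)
    rw [add_assoc, ← add_one_zsmul] at this
    simpa [ray, add_assoc] using this

theorem mem_ray_of_le {e x : Fin d → ℤ} (he : ∀ x, e ∈ G x) {n m : ℤ} (hn : n ∈ ray G e x)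
    (h : n ≤ m) : m ∈ ray G e x := by
  obtain ⟨j, rfl⟩ := Int.le.dest h
  exact ray_add_nat he hn j

theorem mem_ray_add {e x v : Fin d → ℤ} {n : ℤ} (hn : n ∈ ray G e x) (hv : v ∈ G (x + n • e)) :
    n ∈ ray G e (x + v) := by
  have := forward_step hn hv
  rwa [add_right_comm] at this

/-- If full sites occur in both directions on each line parallel to `e`, then the forward cluster
of the origin is everything, or it meets each such line in a half-line. -/
theorem forward_eq_univ_or_ray {e : Fin d → ℤ} (he : ∀ x, e ∈ G x) {full : (Fin d → ℤ) → Prop}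
    (hfull : ∀ x, full x → units d ⊆ G x) (hpos : ∀ x, ∃ n : ℕ, full (x + n • e))
    (hneg : ∀ x, ∃ n : ℕ, full (x - n • e)) :
    forward G 0 = univ ∨ ∀ x, (ray G e x).Nonempty ∧ BddBelow (ray G e x) := by
  have hne : ∀ x, (ray G e x).Nonempty := by
    -- From a point of the cluster, move along `e` to a full site and step across to the
    -- neighbouring line.
    refine units_connected (x := 0) ?_ ⟨0, by simpa [ray] using self_mem_forward 0⟩
    rintro x ⟨n, hn⟩ v hv
    obtain ⟨m, hm⟩ := hpos (x + n • e)
    refine ⟨n + m, mem_ray_add (ray_add_nat he hn m) (hfull _ ?_ hv)⟩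
    rwa [add_zsmul, ← add_assoc, natCast_zsmul]
  by_cases hb : ∀ x, BddBelow (ray G e x)
  · exact Or.inr fun x => ⟨hne x, hb x⟩
  · left
    push Not at hb
    obtain ⟨x, hx⟩ := hb
    rw [eq_univ_iff_forall]
    intro y
    have hy : ¬ BddBelow (ray G e y) := by
      refine units_connected (Q := fun y => ¬ BddBelow (ray G e y)) ?_ hx y
      rintro x hx v hv
      rw [not_bddBelow_iff] at hx ⊢
      intro B
      obtain ⟨m, hm⟩ := hneg (x + (B - 1) • e)
      obtain ⟨n, hn, hnB⟩ := hx (B - 1 - m)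
      -- The full site found to the left of `B` is in the cluster because the ray contains a point
      -- further left.
      refine ⟨B - 1 - m, mem_ray_add (mem_ray_of_le he hn hnB.le) (hfull _ ?_ hv), by omega⟩
      rwa [sub_zsmul _ _ (m : ℤ), natCast_zsmul, ← sub_eq_add_neg, ← add_sub_assoc]
    rw [not_bddBelow_iff] at hy
    obtain ⟨n, hn, hn0⟩ := hy 0
    have := mem_ray_of_le he hn hn0.le
    simpa [ray] using this

theorem lowerEnd_finite {hd : 2 ≤ d} {x : Fin d → ℤ} (h : (ray G (e₁ d hd) x).Nonempty)
    (hb : BddBelow (ray G (e₁ d hd) x)) : ⊥ < lowerEnd hd G x ∧ lowerEnd hd G x < ⊤ := by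
  obtain ⟨n, hn⟩ := h
  obtain ⟨B, hB⟩ := hb
  constructor
  · refine (EReal.bot_lt_coe (B : ℝ)).trans_le (le_sInf ?_)
    rintro _ ⟨m, hm, rfl⟩
    have : (B : ℝ) ≤ m := by exact_mod_cast hB hm
    exact EReal.coe_le_coe_iff.2 this
  · exact (sInf_le (mem_image_of_mem _ hn)).trans_lt (EReal.coe_lt_top _)

end Graph

/-! ### Almost sure dichotomy and zero-one law -/

section

variable {d : ℕ}

/-- Excludes the value 1, which the half-open piece `[0, 1)` of the full environment misses. -/
theorem ae_mem_Ioo : ∀ᵐ ω ∂law d, ∀ i, ω i ∈ Ioo (0 : ℝ) 1 := by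
  rw [ae_all_iff]
  intro i
  have h : ∀ᵐ u ∂unif, u ∈ Ioo (0 : ℝ) 1 := by
    rw [ae_iff]
    exact unif_compl_Ioo
  exact (measurePreserving_eval_infinitePi (fun _ => unif) i).quasiMeasurePreserving.ae h

theorem law_forall_mem (S : Finset (Fin d → ℤ)) {t : Set ℝ} (ht : MeasurableSet t) :
    law d {ω | ∀ x ∈ S, ω (Sum.inl x) ∈ t} = unif t ^ S.card := by
  have h : {ω : (Fin d → ℤ) ⊕ (Fin d → ℤ) → ℝ | ∀ x ∈ S, ω (Sum.inl x) ∈ t} =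
      Set.pi ((S.map ⟨Sum.inl, Sum.inl_injective⟩ : Finset ((Fin d → ℤ) ⊕ (Fin d → ℤ))) :
        Set ((Fin d → ℤ) ⊕ (Fin d → ℤ))) fun _ => t := by
    ext ω
    simp [Set.mem_pi]
  rw [h, law, Measure.infinitePi_pi _ fun _ _ => ht]
  simp

theorem law_closed (S : Finset (Fin d → ℤ)) {p : ℝ} (hp1 : p ≤ 1) :
    law d {ω | ∀ x ∈ S, ω (Sum.inl x) < p} = ENNReal.ofReal p ^ S.card := by
  rw [← unif_Iio hp1]
  exact law_forall_mem S measurableSet_Iio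

theorem law_full (S : Finset (Fin d → ℤ)) {p : ℝ} (hp0 : 0 < p) :
    law d {ω | ∀ x ∈ S, p ≤ ω (Sum.inl x)} = ENNReal.ofReal (1 - p) ^ S.card := by
  rw [← unif_Ici hp0]
  exact law_forall_mem S measurableSet_Ici

theorem ae_exists_full {p : ℝ} (hp1 : p < 1) {g : ℕ → Fin d → ℤ} (hg : Function.Injective g) :
    ∀ᵐ ω ∂law d, ∃ n, p ≤ ω (Sum.inl (g n)) := by
  rw [ae_iff]
  have hle : ∀ N : ℕ, law d {ω | ¬ ∃ n, p ≤ ω (Sum.inl (g n))} ≤ ENNReal.ofReal p ^ N := by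
    intro N
    have h := law_closed (d := d) ((Finset.range N).map ⟨g, hg⟩) hp1.le
    rw [Finset.card_map, Finset.card_range] at h
    rw [← h]
    refine measure_mono fun ω hω x hx => ?_
    obtain ⟨n, -, rfl⟩ := Finset.mem_map.1 hx
    exact not_le.1 fun hn => hω ⟨n, hn⟩
  have hlim := ENNReal.tendsto_pow_atTop_nhds_zero_of_lt_one
    (r := ENNReal.ofReal p)
    (by rw [← ENNReal.ofReal_one]; exact (ENNReal.ofReal_lt_ofReal_iff one_pos).2 hp1)
  exact le_antisymm (ge_of_tendsto' hlim hle) zero_le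

variable {k : ℕ} {E : Fin k → Set (Fin d → ℤ)} {r : Fin k → ℝ}

theorem e₁_ne_zero (hd : 2 ≤ d) : e₁ d hd ≠ 0 := by
  simp [e₁]

/-- Almost surely, the forward cluster of the origin is everything or has finite lower ends. -/
theorem ae_forward_eq_univ_or_ray (hd : 2 ≤ d) (hr1 : ∑ i, r i = 1) (hE₁ : ∀ i, e₁ d hd ∈ E i)
    {p : ℝ} (hp1 : p < 1) :
    ∀ᵐ ω ∂law d, forward (config E r p ω) 0 = univ ∨
      ∀ x, (ray (config E r p ω) (e₁ d hd) x).Nonempty ∧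
        BddBelow (ray (config E r p ω) (e₁ d hd) x) := by
  have hinj : Function.Injective fun n : ℕ => n • e₁ d hd := by
    intro m n h
    have := congrFun h ⟨0, by omega⟩
    simpa [e₁] using this
  have hpos : ∀ᵐ ω ∂law d, ∀ x, ∃ n : ℕ, p ≤ ω (Sum.inl (x + n • e₁ d hd)) :=
    ae_all_iff.2 fun x => ae_exists_full hp1 ((add_right_injective x).comp hinj)
  have hneg : ∀ᵐ ω ∂law d, ∀ x, ∃ n : ℕ, p ≤ ω (Sum.inl (x - n • e₁ d hd)) :=
    ae_all_iff.2 fun x => ae_exists_full hp1 (sub_right_injective.comp hinj)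
  filter_upwards [ae_mem_Ioo, hpos, hneg] with ω hω h1 h2
  exact forward_eq_univ_or_ray (e₁_mem_config hω hr1 hE₁)
    (full := fun x => p ≤ ω (Sum.inl x)) (fun x hx => (config_of_le hω hx).ge) h1 h2

theorem measurableSet_mem_config (p : ℝ) (x e : Fin d → ℤ) :
    MeasurableSet {ω | e ∈ config E r p ω x} := by
  have h1 : Measurable fun ω : (Fin d → ℤ) ⊕ (Fin d → ℤ) → ℝ => ω (Sum.inl x) :=
    measurable_pi_apply _
  have h2 : Measurable fun ω : (Fin d → ℤ) ⊕ (Fin d → ℤ) → ℝ => ω (Sum.inr x) :=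
    measurable_pi_apply _
  have hpiece : ∀ {m : ℕ} (s : Fin m → ℝ) (F : Fin m → Set (Fin d → ℤ)),
      MeasurableSet {ω : (Fin d → ℤ) ⊕ (Fin d → ℤ) → ℝ |
        ∃ i, ω (Sum.inr x) ∈ piece s i ∧ e ∈ F i} := by
    intro m s F
    have : {ω : (Fin d → ℤ) ⊕ (Fin d → ℤ) → ℝ | ∃ i, ω (Sum.inr x) ∈ piece s i ∧ e ∈ F i} =
        ⋃ i, ({ω | ω (Sum.inr x) ∈ piece s i} ∩ {_ω | e ∈ F i}) := by
      ext ω; simp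
    rw [this]
    exact MeasurableSet.iUnion fun i => (h2 measurableSet_Ico).inter (MeasurableSet.const _)
  exact ((h1 measurableSet_Iio).inter (hpiece _ _)).union
    ((h1 measurableSet_Ici).inter (hpiece _ _))

theorem measurableSet_forward_eq_univ (p : ℝ) :
    MeasurableSet {ω | forward (config E r p ω) 0 = univ} := by
  have hwalk : ∀ n (x y : Fin d → ℤ), MeasurableSet {ω | WalkTo (config E r p ω) n x y} := by
    intro n
    induction n with
    | zero => intro x y; exact MeasurableSet.const _
    | succ n ih =>
      intro x y
      have : {ω | WalkTo (config E r p ω) (n + 1) x y} =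
          ⋃ e, ({ω | e ∈ config E r p ω x} ∩ {ω | WalkTo (config E r p ω) n (x + e) y}) := by
        ext ω; simp [WalkTo]
      rw [this]
      exact MeasurableSet.iUnion fun e => (measurableSet_mem_config p x e).inter (ih _ _)
  have : {ω | forward (config E r p ω) 0 = univ} =
      ⋂ y, ⋃ n, {ω | WalkTo (config E r p ω) n 0 y} := by
    ext ω
    simp [eq_univ_iff_forall, mem_forward_iff_exists_walkTo]
  rw [this]
  exact MeasurableSet.iInter fun y => MeasurableSet.iUnion fun n => hwalk n 0 y

/-- The zero-one law for the event that the forward cluster of the origin is everything. -/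
theorem ae_forward_eq_univ_or_ae_ne (hd : 2 ≤ d) (hr1 : ∑ i, r i = 1)
    (hE₁ : ∀ i, e₁ d hd ∈ E i) (p : ℝ) :
    (∀ᵐ ω ∂law d, forward (config E r p ω) 0 = univ) ∨
      ∀ᵐ ω ∂law d, forward (config E r p ω) 0 ≠ univ := by
  set s := {ω | forward (config E r p ω) 0 = univ} with hs
  have hle : shift (e₁ d hd) ⁻¹' s ≤ᵐ[law d] s := by
    filter_upwards [ae_mem_Ioo] with ω hω h
    have h1 : forward (config E r p ω) (e₁ d hd) = univ :=
      (forward_translate_eq_univ_iff _).1 h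
    have h2 : 0 + e₁ d hd ∈ forward (config E r p ω) 0 :=
      forward_step (self_mem_forward 0) (e₁_mem_config hω hr1 hE₁ 0)
    rw [zero_add] at h2
    have h3 := forward_subset_forward h2
    rw [h1] at h3
    exact univ_subset_iff.1 h3
  rcases (ergodic_shift (e₁_ne_zero hd)).ae_empty_or_univ_of_preimage_ae_le
    (measurableSet_forward_eq_univ p).nullMeasurableSet hle with h | h
  · right
    filter_upwards [h] with ω hω h'
    exact (iff_of_eq hω).1 h'
  · left
    filter_upwards [h] with ω hω
    exact (iff_of_eq hω).2 trivial

/-- If the forward cluster of the origin is almost surely everything, so is that of each site. -/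
theorem ae_forall_forward_eq_univ {p : ℝ}
    (h : ∀ᵐ ω ∂law d, forward (config E r p ω) 0 = univ) :
    ∀ᵐ ω ∂law d, ∀ x, forward (config E r p ω) x = univ := by
  rw [ae_all_iff]
  intro x
  filter_upwards [(measurePreserving_shift x).quasiMeasurePreserving.ae h] with ω hω
  exact (forward_translate_eq_univ_iff _).1 hω

end

/-! ### Covering at small parameters: barriers of closed sites -/

section

variable {d : ℕ}

/-- The second canonical basis vector. -/
def e₂ (d : ℕ) (hd : 2 ≤ d) : Fin d → ℤ := Pi.single ⟨1, by omega⟩ 1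

/-- The point with coordinates `(n, m)` in the plane spanned by the first two basis vectors. -/
def site (hd : 2 ≤ d) (n m : ℤ) : Fin d → ℤ := m • e₂ d hd + n • e₁ d hd

theorem site_fst (hd : 2 ≤ d) (n m : ℤ) : site hd n m ⟨0, by omega⟩ = n := by
  simp [site, e₁, e₂]

theorem site_snd (hd : 2 ≤ d) (n m : ℤ) : site hd n m ⟨1, by omega⟩ = m := by
  simp [site, e₁, e₂]

/-- The sites of row `m` with first coordinate in `[b, t)`. -/
noncomputable def rowSegment (hd : 2 ≤ d) (m b t : ℤ) : Finset (Fin d → ℤ) :=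
  (Finset.Ico b t).map ⟨fun n => site hd n m, fun n n' h => by
    simpa [site_fst] using congrFun h ⟨0, by omega⟩⟩

theorem card_rowSegment (hd : 2 ≤ d) (m b t : ℤ) : (rowSegment hd m b t).card = (t - b).toNat := by
  simp [rowSegment]

theorem snd_of_mem_rowSegment {hd : 2 ≤ d} {m b t : ℤ} {x : Fin d → ℤ}
    (hx : x ∈ rowSegment hd m b t) : x ⟨1, by omega⟩ = m := by
  obtain ⟨n, -, rfl⟩ := Finset.mem_map.1 hx
  exact site_snd hd n m

/-- Closed sites force the left ends of `M + 1` consecutive rows, starting with row `m`, where `b`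
is the left end of row `m` and `a` that of the row below it. -/
def Barrier (hd : 2 ≤ d) (closed : (Fin d → ℤ) → Prop) : ℕ → ℤ → ℤ → ℤ → Prop
  | 0, m, a, b => ∀ x ∈ rowSegment hd m b (max (b + 1) a), closed x
  | M + 1, m, a, b => ∃ c, (∀ x ∈ rowSegment hd m b (max (max (b + 1) a) c), closed x) ∧
      Barrier hd closed M (m + 1) b c

theorem tsum_quarter_pow_le (b : ℤ) :
    ∑' c : ℤ, (1 / 4 : ENNReal) * (1 / 4) ^ (c - b).natAbs ≤ 2 / 3 := by
  have h0 := (Equiv.subRight b).tsum_eq fun c => (1 / 4 : ENNReal) ^ c.natAbs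
  simp only [Equiv.subRight_apply] at h0
  -- The two-sided geometric series equals 5/3, so the sum is 5/12.
  rw [ENNReal.tsum_mul_left, h0,
    tsum_of_nat_of_neg_add_one ENNReal.summable ENNReal.summable]
  have h1 : ∀ n : ℕ, (-((n : ℤ) + 1)).natAbs = n + 1 := fun n => by omega
  simp only [h1, Int.natAbs_natCast, pow_succ, ENNReal.tsum_mul_right, ENNReal.tsum_geometric]
  have h2 : (1 - 1 / 4 : ENNReal)⁻¹ = ENNReal.ofReal (4 / 3) := by
    have : (1 - 1 / 4 : ENNReal) = ENNReal.ofReal (3 / 4) := by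
      rw [show (3 / 4 : ℝ) = 1 - 1 / 4 by norm_num, ENNReal.ofReal_sub _ (by norm_num),
        ENNReal.ofReal_div_of_pos (by norm_num)]
      simp
    rw [this, ← ENNReal.ofReal_inv_of_pos (by norm_num)]
    norm_num
  have h3 : (1 / 4 : ENNReal) = ENNReal.ofReal (1 / 4) := by
    rw [ENNReal.ofReal_div_of_pos (by norm_num)]; simp
  have h4 : (2 / 3 : ENNReal) = ENNReal.ofReal (2 / 3) := by
    rw [ENNReal.ofReal_div_of_pos (by norm_num)]; simp
  rw [h2, h3, h4, ← ENNReal.ofReal_mul (by norm_num), ← ENNReal.ofReal_add (by norm_num)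
    (by norm_num), ← ENNReal.ofReal_mul (by norm_num)]
  exact ENNReal.ofReal_le_ofReal (by norm_num)

theorem law_closed_union_rowSegment_le (hd : 2 ≤ d) {p : ℝ} (hp : p ≤ 1 / 64)
    {S : Finset (Fin d → ℤ)} {m b t : ℤ} (hS : ∀ x ∈ S, x ⟨1, by omega⟩ < m) :
    law d {ω | ∀ x ∈ S ∪ rowSegment hd m b t, ω (Sum.inl x) < p} ≤
        ((1 / 4) ^ 3) ^ (S.card + (t - b).toNat) ∧
      (S ∪ rowSegment hd m b t).card = S.card + (t - b).toNat := by
  have hdisj : Disjoint S (rowSegment hd m b t) := by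
    rw [Finset.disjoint_left]
    intro x hx hx'
    have := hS x hx
    rw [snd_of_mem_rowSegment hx'] at this
    exact lt_irrefl _ this
  have hcard : (S ∪ rowSegment hd m b t).card = S.card + (t - b).toNat := by
    rw [Finset.card_union_of_disjoint hdisj, card_rowSegment]
  refine ⟨?_, hcard⟩
  rw [law_closed _ (by linarith), hcard]
  gcongr
  refine (ENNReal.ofReal_le_ofReal hp).trans (le_of_eq ?_)
  rw [show (1 / 64 : ℝ) = (1 / 4) ^ 3 by norm_num, ENNReal.ofReal_pow (by norm_num),
    ENNReal.ofReal_div_of_pos (by norm_num)]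
  simp

/-- `S` holds the closed sites exposed in lower rows, disjoint from the current one. Each closed
site costs at most three factors 1/4. They pay for the offset from the row below, for one spare
factor, and for a rightward move of the next left end. A leftward move is paid by the next row,
which is why the bound carries a power of the positive part of `a - b`. -/
theorem law_barrier_le (hd : 2 ≤ d) {p : ℝ} (hp : p ≤ 1 / 64) (M : ℕ) :
    ∀ (m a b : ℤ) (S : Finset (Fin d → ℤ)), (∀ x ∈ S, x ⟨1, by omega⟩ < m) →
      law d {ω | (∀ x ∈ S, ω (Sum.inl x) < p) ∧
          Barrier hd (fun x => ω (Sum.inl x) < p) M m a b} ≤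
        ((1 / 4) ^ 3) ^ S.card * (2 / 3) ^ M * (1 / 4) ^ (a - b).toNat := by
  have hq : (1 / 4 : ENNReal) ≤ 1 := by
    rw [one_div]; exact ENNReal.inv_le_one.2 (by norm_num)
  induction M with
  | zero =>
    intro m a b S hS
    refine (measure_mono (t := {ω | ∀ x ∈ S ∪ rowSegment hd m b (max (b + 1) a),
      ω (Sum.inl x) < p}) ?_).trans ((law_closed_union_rowSegment_le hd hp hS).1.trans ?_)
    · rintro ω ⟨h1, h2⟩ x hx
      exact (Finset.mem_union.1 hx).elim (h1 x) (h2 x)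
    · rw [pow_zero, mul_one, pow_add]
      refine mul_le_mul_right ?_ _
      rw [← pow_mul]
      exact pow_le_pow_of_le_one zero_le hq (by omega)
  | succ M ih =>
    intro m a b S hS
    have hterm : ∀ c : ℤ, law d {ω | (∀ x ∈ S ∪ rowSegment hd m b (max (max (b + 1) a) c),
          ω (Sum.inl x) < p) ∧ Barrier hd (fun x => ω (Sum.inl x) < p) M (m + 1) b c} ≤
        (((1 / 4) ^ 3) ^ S.card * (2 / 3) ^ M * (1 / 4) ^ (a - b).toNat) *
          ((1 / 4) * (1 / 4) ^ (c - b).natAbs) := by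
      intro c
      refine (ih (m + 1) b c _ ?_).trans ?_
      · intro x hx
        rcases Finset.mem_union.1 hx with h | h
        · exact (hS x h).trans (lt_add_one m)
        · rw [snd_of_mem_rowSegment h]; exact lt_add_one m
      · rw [(law_closed_union_rowSegment_le hd hp hS).2, pow_add]
        -- With `L` the segment length, this is `3L + (b - c)⁺ ≥ (a - b)⁺ + 1 + |c - b|`; check `c ≥
        -- b` and `c < b` separately.
        have hpow : ((1 / 4 : ENNReal) ^ 3) ^ (max (max (b + 1) a) c - b).toNat *
            (1 / 4) ^ (b - c).toNat ≤
            (1 / 4) ^ (a - b).toNat * ((1 / 4) * (1 / 4) ^ (c - b).natAbs) := by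
          rw [← pow_succ', ← pow_mul, ← pow_add, ← pow_add]
          exact pow_le_pow_of_le_one zero_le hq (by omega)
        calc _ = ((1 / 4) ^ 3) ^ S.card * (2 / 3) ^ M *
              (((1 / 4 : ENNReal) ^ 3) ^ (max (max (b + 1) a) c - b).toNat *
                (1 / 4) ^ (b - c).toNat) := by ring
          _ ≤ ((1 / 4) ^ 3) ^ S.card * (2 / 3) ^ M *
              ((1 / 4) ^ (a - b).toNat * ((1 / 4) * (1 / 4) ^ (c - b).natAbs)) := by gcongr
          _ = _ := by ring
    calc _ ≤ law d (⋃ c : ℤ, {ω | (∀ x ∈ S ∪ rowSegment hd m b (max (max (b + 1) a) c),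
          ω (Sum.inl x) < p) ∧ Barrier hd (fun x => ω (Sum.inl x) < p) M (m + 1) b c}) := by
          refine measure_mono ?_
          rintro ω ⟨h1, c, h2, h3⟩
          exact mem_iUnion.2 ⟨c, fun x hx => (Finset.mem_union.1 hx).elim (h1 x) (h2 x), h3⟩
      _ ≤ ∑' c : ℤ, (((1 / 4) ^ 3) ^ S.card * (2 / 3) ^ M * (1 / 4) ^ (a - b).toNat) *
          ((1 / 4) * (1 / 4) ^ (c - b).natAbs) :=
          (measure_iUnion_le _).trans (ENNReal.tsum_le_tsum hterm)
      _ ≤ (((1 / 4) ^ 3) ^ S.card * (2 / 3) ^ M * (1 / 4) ^ (a - b).toNat) * (2 / 3) := by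
          rw [ENNReal.tsum_mul_left]
          gcongr
          exact tsum_quarter_pow_le b
      _ = _ := by ring

theorem ae_not_forall_barrier (hd : 2 ≤ d) {p : ℝ} (hp : p ≤ 1 / 64) (m : ℤ) :
    ∀ᵐ ω ∂law d, ∀ a b, ∃ M, ¬ Barrier hd (fun x => ω (Sum.inl x) < p) M m a b := by
  refine ae_all_iff.2 fun a => ae_all_iff.2 fun b => ?_
  rw [ae_iff]
  have hle : ∀ M : ℕ, law d {ω | ¬ ∃ M, ¬ Barrier hd (fun x => ω (Sum.inl x) < p) M m a b} ≤
      (2 / 3) ^ M := by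
    intro M
    have h := law_barrier_le hd hp M m a b ∅ (by simp)
    refine (measure_mono ?_).trans (h.trans ?_)
    · intro ω hω
      exact ⟨by simp, by_contra fun h => hω ⟨M, h⟩⟩
    · rw [Finset.card_empty, pow_zero, one_mul]
      refine mul_le_of_le_one_right' (pow_le_one₀ zero_le ?_)
      rw [one_div]; exact ENNReal.inv_le_one.2 (by norm_num)
  have hlim := ENNReal.tendsto_pow_atTop_nhds_zero_of_lt_one (r := 2 / 3)
    (by rw [ENNReal.div_lt_iff] <;> norm_num)
  exact le_antisymm (ge_of_tendsto' hlim hle) zero_le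

/-- A full cluster site sends the cluster one step left and into both adjacent rows at the same
abscissa. It therefore lies strictly right of its own row's left end and not left of the
neighbouring ends, so all row sites before that are closed. -/
theorem exists_barrier (hd : 2 ≤ d) {G : (Fin d → ℤ) → Set (Fin d → ℤ)}
    (he : ∀ x, e₁ d hd ∈ G x)
    {full : (Fin d → ℤ) → Prop} (hfull : ∀ x, full x → units d ⊆ G x)
    (hray : ∀ x, (ray G (e₁ d hd) x).Nonempty ∧ BddBelow (ray G (e₁ d hd) x)) (m : ℤ) :
    ∃ a b, ∀ M, Barrier hd (fun x => ¬ full x) M m a b := by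
  have hmin : ∀ m : ℤ, ∃ a : ℤ, a ∈ ray G (e₁ d hd) (m • e₂ d hd) ∧
      ∀ n ∈ ray G (e₁ d hd) (m • e₂ d hd), a ≤ n := by
    intro m
    obtain ⟨hne, B, hB⟩ := hray (m • e₂ d hd)
    exact Int.exists_least_of_bdd ⟨B, fun z hz => hB hz⟩ hne
  choose a ha hamin using hmin
  have hrow : ∀ m n : ℤ, a m ≤ n → n < max (max (a m + 1) (a (m - 1))) (a (m + 1)) →
      ¬ full (site hd n m) := by
    intro m n h1 h2 hf
    have hn := mem_ray_of_le he (ha m) h1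
    have hleft : n - 1 ∈ ray G (e₁ d hd) (m • e₂ d hd) := by
      have := forward_step hn (hfull _ hf (⟨_, Or.inr rfl⟩ : -e₁ d hd ∈ units d))
      rwa [add_assoc, ← sub_one_zsmul] at this
    have hup : n ∈ ray G (e₁ d hd) ((m + 1) • e₂ d hd) := by
      rw [add_one_zsmul]
      exact mem_ray_add hn (hfull _ hf ⟨_, Or.inl rfl⟩)
    have hdown : n ∈ ray G (e₁ d hd) ((m - 1) • e₂ d hd) := by
      rw [sub_one_zsmul]
      exact mem_ray_add hn (hfull _ hf ⟨_, Or.inr rfl⟩)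
    have h3 := hamin _ _ hleft
    have h4 := hamin _ _ hup
    have h5 := hamin _ _ hdown
    omega
  refine ⟨a (m - 1), a m, fun M => ?_⟩
  induction M generalizing m with
  | zero =>
    intro x hx
    obtain ⟨n, hn, rfl⟩ := Finset.mem_map.1 hx
    rw [Finset.mem_Ico] at hn
    exact hrow m n hn.1 (lt_max_of_lt_left hn.2)
  | succ M ih =>
    refine ⟨a (m + 1), ?_, by simpa using ih (m + 1)⟩
    intro x hx
    obtain ⟨n, hn, rfl⟩ := Finset.mem_map.1 hx
    rw [Finset.mem_Ico] at hn
    exact hrow m n hn.1 hn.2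

theorem ae_forward_eq_univ_of_small (hd : 2 ≤ d) {k : ℕ} {E : Fin k → Set (Fin d → ℤ)}
    {r : Fin k → ℝ} (hr1 : ∑ i, r i = 1) (hE₁ : ∀ i, e₁ d hd ∈ E i) :
    ∀ᵐ ω ∂law d, forward (config E r (1 / 64) ω) 0 = univ := by
  filter_upwards [ae_mem_Ioo, ae_forward_eq_univ_or_ray hd hr1 hE₁ (p := 1 / 64) (by norm_num),
    ae_not_forall_barrier hd (p := 1 / 64) le_rfl 0] with ω hω h1 h2
  refine h1.resolve_right fun h => ?_
  obtain ⟨a, b, hab⟩ := exists_barrier hd (e₁_mem_config hω hr1 hE₁)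
    (full := fun x => 1 / 64 ≤ ω (Sum.inl x))
    (fun x hx => (config_of_le hω hx).ge) h 0
  obtain ⟨M, hM⟩ := h2 a b
  exact hM (by simpa only [not_le] using hab M)

end

/-! ### Non-covering at large parameters: counting avoiding walks -/

section

variable {d : ℕ}

/-- There is a walk of `n` unit steps from `x` to `y` without repeated sites that avoids `W`
before its end and takes negative steps at full sites only. -/
def AvoidingWalk (full : (Fin d → ℤ) → Prop) :
    ℕ → Finset (Fin d → ℤ) → (Fin d → ℤ) → (Fin d → ℤ) → Prop
  | 0, _, x, y => x = y
  | n + 1, W, x, y => x ∉ W ∧ ∃ i : Fin d,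
      AvoidingWalk full n (insert x W) (x + Pi.single i 1) y ∨
        (full x ∧ AvoidingWalk full n (insert x W) (x - Pi.single i 1) y)

/-- A shortest walk is an avoiding walk. -/
theorem WalkTo.avoidingWalk {G : (Fin d → ℤ) → Set (Fin d → ℤ)} {full : (Fin d → ℤ) → Prop}
    (hG : ∀ x, ∀ e ∈ G x, e ∈ posUnits d ∨ (full x ∧ e ∈ units d)) {y : Fin d → ℤ} (n : ℕ) :
    ∀ (W : Finset (Fin d → ℤ)) (x : Fin d → ℤ), WalkTo G n x y → (∀ m < n, ¬ WalkTo G m x y) →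
      (∀ w ∈ W, ∀ m ≤ n, ¬ WalkTo G m w y) → AvoidingWalk full n W x y := by
  induction n with
  | zero => intro W x h _ _; exact h
  | succ n ih =>
    rintro W x h hmin hW
    have h' := h
    obtain ⟨e, he, hwalk⟩ := h'
    refine ⟨fun hx => hW x hx _ le_rfl h, ?_⟩
    have hrec : AvoidingWalk full n (insert x W) (x + e) y := by
      refine ih _ _ hwalk (fun m hm h' => hmin (m + 1) (by omega) ⟨e, he, h'⟩) ?_
      -- Visited sites are too far from `y` to be met again; for the current site this is minimality
      -- of `n + 1`.
      intro w hw m hm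
      rcases Finset.mem_insert.1 hw with rfl | hw
      · exact hmin m (by omega)
      · exact hW w hw m (by omega)
    -- A positive step out of a full site is counted as an ordinary positive step, without using
    -- fullness.
    rcases hG x e he with ⟨i, rfl⟩ | ⟨hf, i, rfl | rfl⟩
    · exact ⟨i, Or.inl hrec⟩
    · exact ⟨i, Or.inl hrec⟩
    · exact ⟨i, Or.inr ⟨hf, by rwa [sub_eq_add_neg]⟩⟩

theorem exists_avoidingWalk {G : (Fin d → ℤ) → Set (Fin d → ℤ)} {full : (Fin d → ℤ) → Prop}
    (hG : ∀ x, ∀ e ∈ G x, e ∈ posUnits d ∨ (full x ∧ e ∈ units d)) {x y : Fin d → ℤ}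
    (h : y ∈ forward G x) : ∃ n, AvoidingWalk full n ∅ x y := by
  classical
  have h' := mem_forward_iff_exists_walkTo.1 h
  exact ⟨Nat.find h', WalkTo.avoidingWalk hG _ _ _ (Nat.find_spec h')
    (fun m hm => Nat.find_min h' hm) (by simp)⟩

theorem sum_add_single (x : Fin d → ℤ) (i : Fin d) :
    ∑ j, (x + Pi.single i 1 : Fin d → ℤ) j = ∑ j, x j + 1 := by
  simp [Finset.sum_add_distrib]

theorem sum_sub_single (x : Fin d → ℤ) (i : Fin d) :
    ∑ j, (x - Pi.single i 1 : Fin d → ℤ) j = ∑ j, x j - 1 := by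
  simp [Finset.sum_sub_distrib]

/-- Weight a position by `δ` to the power of its coordinate sum. A positive step gains `δ`; a
negative step loses `δ` but needs a fresh full site, of probability `δ ^ 2`, and so also gains `δ`
net. The `2d` choices together give the factor 1/2 per step. -/
theorem law_avoidingWalk_le {p : ℝ} (hp0 : 0 < p) {δ : ENNReal} (hδ0 : δ ≠ 0) (hδ : δ ≠ ⊤)
    (hpδ : ENNReal.ofReal (1 - p) = δ ^ 2) (hdδ : 2 * d * δ = 1 / 2) (y : Fin d → ℤ) (n : ℕ) :
    ∀ (S W : Finset (Fin d → ℤ)) (x : Fin d → ℤ), S ⊆ W →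
      law d {ω | (∀ s ∈ S, p ≤ ω (Sum.inl s)) ∧
          AvoidingWalk (fun x => p ≤ ω (Sum.inl x)) n W x y} ≤
        (δ ^ 2) ^ S.card * (1 / 2) ^ n * δ ^ (∑ j, x j - ∑ j, y j) := by
  induction n with
  | zero =>
    intro S W x _
    by_cases hxy : x = y
    · subst hxy
      simp only [sub_self, zpow_zero, pow_zero, mul_one]
      rw [← hpδ, ← law_full S hp0]
      exact measure_mono fun ω hω => hω.1
    · simp [AvoidingWalk, hxy]
  | succ n ih =>
    intro S W x hSW
    set full : ((Fin d → ℤ) ⊕ (Fin d → ℤ) → ℝ) → (Fin d → ℤ) → Prop :=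
      fun ω x => p ≤ ω (Sum.inl x) with hfull
    set h : ℤ := ∑ j, x j - ∑ j, y j with hh
    by_cases hxW : x ∈ W
    · simp [AvoidingWalk, hxW]
    have hxS : x ∉ S := fun hx => hxW (hSW hx)
    have hpos : ∀ i : Fin d, law d {ω | (∀ s ∈ S, full ω s) ∧
        AvoidingWalk (full ω) n (insert x W) (x + Pi.single i 1) y} ≤
        (δ ^ 2) ^ S.card * (1 / 2) ^ n * δ ^ h * δ := by
      intro i
      refine (ih S (insert x W) _ (hSW.trans (Finset.subset_insert _ _))).trans (le_of_eq ?_)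
      rw [sum_add_single, add_sub_right_comm, ENNReal.zpow_add hδ0 hδ, zpow_one]
      ring
    have hneg : ∀ i : Fin d, law d {ω | (∀ s ∈ insert x S, full ω s) ∧
        AvoidingWalk (full ω) n (insert x W) (x - Pi.single i 1) y} ≤
        (δ ^ 2) ^ S.card * (1 / 2) ^ n * δ ^ h * δ := by
      intro i
      refine (ih (insert x S) (insert x W) _ (Finset.insert_subset_insert x hSW)).trans
        (le_of_eq ?_)
      have h1 : δ ^ h = δ ^ (h - 1) * δ := by
        conv_lhs => rw [← sub_add_cancel h 1, ENNReal.zpow_add hδ0 hδ, zpow_one]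
      rw [sum_sub_single, sub_right_comm, ← hh, Finset.card_insert_of_notMem hxS, h1]
      ring
    calc _ ≤ law d (⋃ i : Fin d, ({ω | (∀ s ∈ S, full ω s) ∧
            AvoidingWalk (full ω) n (insert x W) (x + Pi.single i 1) y} ∪
          {ω | (∀ s ∈ insert x S, full ω s) ∧
            AvoidingWalk (full ω) n (insert x W) (x - Pi.single i 1) y})) := by
          refine measure_mono ?_
          rintro ω ⟨h1, -, i, h2 | ⟨h2, h3⟩⟩
          · exact mem_iUnion.2 ⟨i, Or.inl ⟨h1, h2⟩⟩
          · exact mem_iUnion.2 ⟨i, Or.inr ⟨(Finset.forall_mem_insert _ _ _).2 ⟨h2, h1⟩, h3⟩⟩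
      _ ≤ ∑ _i : Fin d, ((δ ^ 2) ^ S.card * (1 / 2) ^ n * δ ^ h * δ +
            (δ ^ 2) ^ S.card * (1 / 2) ^ n * δ ^ h * δ) :=
          (measure_iUnion_fintype_le _ _).trans (Finset.sum_le_sum fun i _ =>
            (measure_union_le _ _).trans (add_le_add (hpos i) (hneg i)))
      _ = (δ ^ 2) ^ S.card * (1 / 2) ^ n * δ ^ h * (2 * d * δ) := by
          rw [Finset.sum_const, Finset.card_univ, Fintype.card_fin, nsmul_eq_mul]
          ring
      _ = _ := by rw [hdδ]; ring

/-- A value of the parameter above which the forward cluster is not everything. -/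
noncomputable def upperParam (d : ℕ) : ℝ := 1 - (1 / (4 * d)) ^ 2

theorem upperParam_lt_one (hd : 2 ≤ d) : upperParam d < 1 := by
  have : (0 : ℝ) < d := by exact_mod_cast (by omega : 0 < d)
  have : (0 : ℝ) < (1 / (4 * d)) ^ 2 := by positivity
  simp only [upperParam]; linarith

theorem upperParam_pos (hd : 2 ≤ d) : 0 < upperParam d := by
  have : (2 : ℝ) ≤ d := by exact_mod_cast hd
  have h1 : (1 : ℝ) / (4 * d) ≤ 1 / 8 := one_div_le_one_div_of_le (by norm_num) (by linarith)
  have h2 : (0 : ℝ) ≤ 1 / (4 * d) := by positivity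
  simp only [upperParam]; nlinarith

theorem ae_forward_ne_univ_of_upperParam (hd : 2 ≤ d) {k : ℕ} {E : Fin k → Set (Fin d → ℤ)}
    {r : Fin k → ℝ} (hE : ∀ i, E i ⊆ posUnits d) :
    ∀ᵐ ω ∂law d, forward (config E r (upperParam d) ω) 0 ≠ univ := by
  have hd0 : (0 : ℝ) < d := by exact_mod_cast (by omega : 0 < d)
  set δ : ENNReal := ENNReal.ofReal (1 / (4 * d)) with hδdef
  have hδ0 : δ ≠ 0 := by rw [hδdef, ne_eq, ENNReal.ofReal_eq_zero, not_le]; positivity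
  have hδ1 : δ < 1 := by
    rw [hδdef, ← ENNReal.ofReal_one]
    refine (ENNReal.ofReal_lt_ofReal_iff one_pos).2 ?_
    rw [div_lt_one (by positivity)]
    have : (2 : ℝ) ≤ d := by exact_mod_cast hd
    linarith
  have hpδ : ENNReal.ofReal (1 - upperParam d) = δ ^ 2 := by
    rw [upperParam, sub_sub_cancel, ENNReal.ofReal_pow (by positivity)]
  have hdδ : 2 * d * δ = 1 / 2 := by
    rw [hδdef, ← ENNReal.ofReal_natCast, ← ENNReal.ofReal_ofNat 2,
      ← ENNReal.ofReal_mul (by norm_num), ← ENNReal.ofReal_mul (by positivity),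
      ← ENNReal.ofReal_one, ← ENNReal.ofReal_div_of_pos (by norm_num)]
    congr 1
    field_simp
    norm_num
  have hne0 : ∀ᵐ ω ∂law d, ∃ n : ℕ, -(n • e₁ d hd) ∉ forward (config E r (upperParam d) ω) 0 := by
    -- The restriction to values in the open interval is kept inside the event because the inclusion
    -- into walk events needs it.
    have hle : ∀ n : ℕ, law d {ω | (∀ i, ω i ∈ Ioo (0 : ℝ) 1) ∧
        ∀ n : ℕ, -(n • e₁ d hd) ∈ forward (config E r (upperParam d) ω) 0} ≤ 2 * δ ^ n := by
      intro n
      have hsub : {ω | (∀ i, ω i ∈ Ioo (0 : ℝ) 1) ∧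
          ∀ n : ℕ, -(n • e₁ d hd) ∈ forward (config E r (upperParam d) ω) 0} ⊆
          ⋃ N : ℕ, {ω | (∀ s ∈ (∅ : Finset (Fin d → ℤ)), upperParam d ≤ ω (Sum.inl s)) ∧
            AvoidingWalk (fun x => upperParam d ≤ ω (Sum.inl x)) N ∅ 0 (-(n • e₁ d hd))} := by
        rintro ω ⟨hω, h⟩
        obtain ⟨N, hN⟩ := exists_avoidingWalk (full := fun x => upperParam d ≤ ω (Sum.inl x))
          (fun x e he => by
            rcases le_or_gt (upperParam d) (ω (Sum.inl x)) with h | h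
            · exact Or.inr ⟨h, by rwa [config_of_le hω h] at he⟩
            · exact Or.inl (config_subset_posUnits hE h he)) (h n)
        exact mem_iUnion.2 ⟨N, by simp, hN⟩
      -- The coordinate sum must fall by `n`, which yields the decay `δ ^ n` after summing over walk
      -- lengths.
      have hsum : ∑ j, (0 : Fin d → ℤ) j - ∑ j, (-(n • e₁ d hd)) j = n := by
        simp [e₁, ← Finset.mul_sum]
      refine (measure_mono hsub).trans ((measure_iUnion_le _).trans ?_)
      calc _ ≤ ∑' N : ℕ, (1 / 2 : ENNReal) ^ N * δ ^ n := by
            refine ENNReal.tsum_le_tsum fun N => ?_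
            have := law_avoidingWalk_le (upperParam_pos hd) hδ0 hδ1.ne_top hpδ hdδ
              (-(n • e₁ d hd)) N ∅ ∅ 0 subset_rfl
            rwa [hsum, Finset.card_empty, pow_zero, one_mul, zpow_natCast] at this
        _ = 2 * δ ^ n := by
            rw [ENNReal.tsum_mul_right, ENNReal.tsum_geometric]
            simp [ENNReal.one_sub_inv_two]
    have hlim : Filter.Tendsto (fun n : ℕ => 2 * δ ^ n) Filter.atTop (nhds 0) := by
      simpa using ENNReal.Tendsto.const_mul (ENNReal.tendsto_pow_atTop_nhds_zero_of_lt_one hδ1)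
        (Or.inr (by norm_num : (2 : ENNReal) ≠ ⊤))
    have h0 := le_antisymm (ge_of_tendsto' hlim hle) zero_le
    have h0' := measure_eq_zero_iff_ae_notMem.1 h0
    filter_upwards [h0', ae_mem_Ioo] with ω h1 h2
    by_contra! h3
    exact h1 ⟨h2, h3⟩
  filter_upwards [hne0] with ω ⟨n, hn⟩ h
  exact hn (h ▸ mem_univ _)

end

/-! ### The critical value as a supremum -/

/-- The parameters for which the forward cluster of the origin is almost surely everything. -/
def coveringParams {d k : ℕ} (E : Fin k → Set (Fin d → ℤ)) (r : Fin k → ℝ) : Set ℝ :=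
  {p | 0 ≤ p ∧ p ≤ 1 ∧ ∀ᵐ ω ∂law d, forward (config E r p ω) 0 = univ}

variable {d k : ℕ} {E : Fin k → Set (Fin d → ℤ)} {r : Fin k → ℝ}

theorem ae_forward_eq_univ_anti (hE : ∀ i, E i ⊆ posUnits d) {p p' : ℝ} (h : p ≤ p')
    (hp' : ∀ᵐ ω ∂law d, forward (config E r p' ω) 0 = univ) :
    ∀ᵐ ω ∂law d, forward (config E r p ω) 0 = univ := by
  filter_upwards [ae_mem_Ioo, hp'] with ω hω h'
  exact univ_subset_iff.1 (h' ▸ forward_mono (config_anti hω hE h) 0)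

theorem coveringParams_le (hd : 2 ≤ d) (hE : ∀ i, E i ⊆ posUnits d) {p : ℝ}
    (hp : p ∈ coveringParams E r) : p ≤ upperParam d := by
  by_contra! h
  have h1 := ae_forward_eq_univ_anti hE h.le hp.2.2
  obtain ⟨ω, h2, h3⟩ := (h1.and (ae_forward_ne_univ_of_upperParam (r := r) hd hE)).exists
  exact h3 h2

theorem mem_coveringParams (hd : 2 ≤ d) (hr1 : ∑ i, r i = 1) (hE₁ : ∀ i, e₁ d hd ∈ E i) :
    1 / 64 ∈ coveringParams E r :=
  ⟨by norm_num, by norm_num, ae_forward_eq_univ_of_small hd hr1 hE₁⟩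

theorem ae_forward_eq_univ_of_lt_sSup (hd : 2 ≤ d) (hr1 : ∑ i, r i = 1)
    (hE₁ : ∀ i, e₁ d hd ∈ E i) (hE : ∀ i, E i ⊆ posUnits d) {p : ℝ}
    (hp : p < sSup (coveringParams E r)) :
    ∀ᵐ ω ∂law d, forward (config E r p ω) 0 = univ := by
  obtain ⟨q, hq, hpq⟩ := exists_lt_of_lt_csSup ⟨_, mem_coveringParams hd hr1 hE₁⟩ hp
  exact ae_forward_eq_univ_anti hE hpq.le hq.2.2

theorem ae_forward_ne_univ_of_sSup_lt (hd : 2 ≤ d) (hr1 : ∑ i, r i = 1)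
    (hE₁ : ∀ i, e₁ d hd ∈ E i) (hE : ∀ i, E i ⊆ posUnits d) {p : ℝ}
    (hp : sSup (coveringParams E r) < p) (hp1 : p ≤ 1) :
    ∀ᵐ ω ∂law d, forward (config E r p ω) 0 ≠ univ := by
  have hbdd : BddAbove (coveringParams E r) := ⟨_, fun _ => coveringParams_le hd hE⟩
  -- This also makes `p` nonnegative, as membership in `coveringParams` requires.
  have h64 := le_csSup hbdd (mem_coveringParams hd hr1 hE₁)
  refine (ae_forward_eq_univ_or_ae_ne hd hr1 hE₁ p).resolve_left fun h => ?_
  exact absurd (le_csSup hbdd ⟨by linarith, hp1, h⟩) (not_le.2 hp)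

end DRE

theorem corollary1 {d k : ℕ} (hd : 2 ≤ d) (E : Fin k → Set (Fin d → ℤ)) (r : Fin k → ℝ)
    (hr : ∀ i, 0 ≤ r i) (hr1 : ∑ i, r i = 1)
    (hE₁ : ∀ i, DRE.e₁ d hd ∈ E i) (hE : ∀ i, E i ⊆ DRE.posUnits d) :
    ∃ pc : ℝ, 0 < pc ∧ pc < 1 ∧
      ∀ (Ω : Type*) [MeasurableSpace Ω] (P : Measure Ω) [IsProbabilityMeasure P]
        (U U' : (Fin d → ℤ) → Ω → ℝ), DRE.IsIIDUniform P U U' →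
      -- `pc` is the critical value of the forward cluster
      ((∀ p : ℝ, 0 ≤ p → p < pc →
          ∀ᵐ ω ∂P, DRE.forward (DRE.envFull E r U U' p ω) 0 = univ) ∧
        (∀ p : ℝ, pc < p → p < 1 →
          ∀ᵐ ω ∂P, ∀ x, ⊥ < DRE.lowerEnd hd (DRE.envFull E r U U' p ω) x ∧
            DRE.lowerEnd hd (DRE.envFull E r U U' p ω) x < ⊤) ∧
        (∀ p : ℝ, pc < p → p ≤ 1 →
          ∀ᵐ ω ∂P, DRE.forward (DRE.envFull E r U U' p ω) 0 ≠ univ)) ∧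
      -- the mutual cluster has its transition at the same value
      ((∀ p : ℝ, 0 ≤ p → p < pc →
          ∀ᵐ ω ∂P, DRE.mutualCluster (DRE.envFull E r U U' p ω) 0 = univ) ∧
        (∀ p : ℝ, pc < p → p ≤ 1 →
          ∀ᵐ ω ∂P, DRE.mutualCluster (DRE.envFull E r U U' p ω) 0 ≠ univ)) := by
  have hmem := DRE.mem_coveringParams (r := r) hd hr1 hE₁
  have hle : ∀ p ∈ DRE.coveringParams E r, p ≤ DRE.upperParam d :=
    fun p hp => DRE.coveringParams_le hd hE hp
  refine ⟨sSup (DRE.coveringParams E r), ?_, ?_, ?_⟩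
  · exact lt_of_lt_of_le (by norm_num) (le_csSup ⟨_, hle⟩ hmem)
  · exact (csSup_le ⟨_, hmem⟩ hle).trans_lt (DRE.upperParam_lt_one hd)
  intro Ω _ P _ U U' hU
  have transfer : ∀ {Q : ((Fin d → ℤ) ⊕ (Fin d → ℤ) → ℝ) → Prop},
      (∀ᵐ ω ∂DRE.law d, Q ω) → ∀ᵐ ω ∂P, Q fun i => Sum.elim U U' i ω :=
    fun h => hU.measurePreserving.quasiMeasurePreserving.ae h
  have hlow := fun {p} hp => DRE.ae_forward_eq_univ_of_lt_sSup (p := p) hd hr1 hE₁ hE hp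
  have hup := fun {p} hp hp1 => DRE.ae_forward_ne_univ_of_sSup_lt (p := p) hd hr1 hE₁ hE hp hp1
  refine ⟨⟨fun p _ hp => transfer (hlow hp), fun p hp hp1 => ?_,
    fun p hp hp1 => transfer (hup hp hp1)⟩, fun p _ hp => ?_, fun p hp hp1 => ?_⟩
  · filter_upwards [transfer (hup hp hp1.le),
      transfer (DRE.ae_forward_eq_univ_or_ray hd hr1 hE₁ hp1)] with ω h1 h2 x
    have h3 := h2.resolve_left h1 x
    exact DRE.lowerEnd_finite h3.1 h3.2
  · filter_upwards [transfer (DRE.ae_forall_forward_eq_univ (hlow hp))] with ω hω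
    -- The backward half needs covering from every `y` on one almost sure event, not only from the
    -- origin.
    refine eq_univ_iff_forall.2 fun y => ⟨?_, ?_⟩
    · exact (hω 0).ge (mem_univ y)
    · exact (hω y).ge (mem_univ 0)
  · filter_upwards [transfer (hup hp hp1)] with ω h1 h2
    exact h1 (univ_subset_iff.1 (h2 ▸ inter_subset_left))
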